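/- For integers $d\ge 1$ and $s_1\ge 2$, $s_2,\dots,s_d\ge 1$ let $$\zeta(s_1,\dots,s_d)=\sum_{k_1>k_2>\cdots>k_d>0}\frac{1}{k_1^{s_1}k_2^{s_2}\cdots k_d^{s_d}}$$ be the (convergent) multiple zeta value, the sum being over integers $k_1,\dots,k_d$. Then for every integer $n\ge 4$ $$\sum_{\substack{j\ge 2,\ k,l\ge 1\\ j+k+l=n}}\bigl(2^{j+1}+2^k\bigr)\zeta(j,k,l) -\sum_{\substack{j\ge 2,\ k\ge 1\\ j+k=n-1}}2^j\bigl(\zeta(j,1,k)+\zeta(j,k,1)\bigr) +\sum_{\substack{j\ge 2,\ k\ge 1\\ j+k=n}}2^j\,k\,\zeta(j,k)$$ $$=\frac{(n+3)(n+1)}{2}\,\zeta(n)-3\,\zeta(n-2,2)-\bigl(2^{n-1}+n\bigr)\zeta(n-1,1)-3\,\zeta(2,n-2).$$ -/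

import Mathlib

/-- The summation range of a multiple zeta series of depth `d`: strictly decreasing
tuples `k₁ > k₂ > ⋯ > k_d > 0` of positive integers. -/
def DecreasingTuple (d : ℕ) : Type :=
  {k : Fin d → ℕ // StrictAnti k ∧ ∀ i, 0 < k i}

/-- The summand `1 / (k₁ ^ s₁ ⋯ k_d ^ s_d)`. -/
noncomputable def multipleZetaTerm {d : ℕ} (s : Fin d → ℕ) (k : DecreasingTuple d) : ℝ :=
  1 / ∏ i, (k.1 i : ℝ) ^ s i

/-- The multiple zeta value `ζ(s₁, …, s_d) = ∑_{k₁ > ⋯ > k_d > 0} 1 / (k₁ ^ s₁ ⋯ k_d ^ s_d)`.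
It is only meaningful for `s₁ ≥ 2` and all other `sᵢ ≥ 1`, where the series converges
(see `summable_multipleZetaTerm`). -/
noncomputable def multipleZeta {d : ℕ} (s : Fin d → ℕ) : ℝ :=
  ∑' k : DecreasingTuple d, multipleZetaTerm s k

theorem summable_prod_fin {f : ℕ → ℝ} (hf : Summable f) (h0 : ∀ n, 0 ≤ f n) (d : ℕ) :
    Summable (fun k : Fin d → ℕ => ∏ i, f (k i)) := by
  induction d with
  | zero => exact (hasSum_fintype _).summable
  | succ m ih =>
    rw [← (Fin.consEquiv (fun _ : Fin (m + 1) => ℕ)).summable_iff]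
    refine (hf.mul_of_nonneg ih h0 fun k => Finset.prod_nonneg fun i _ => h0 _).congr ?_
    intro x
    simp [Fin.consEquiv, Fin.prod_univ_succ]

/-- Convergence of the multiple zeta series for `s₁ ≥ 2` and `s₂, …, s_d ≥ 1`. -/
theorem summable_multipleZetaTerm {m : ℕ} (s : Fin (m + 1) → ℕ) (h2 : 2 ≤ s 0)
    (h1 : ∀ i, 1 ≤ s i) : Summable (multipleZetaTerm s) := by
  have hm : (0 : ℝ) < (m : ℝ) + 1 := by positivity
  set e : ℝ := 1 / ((m : ℝ) + 1) with he
  have hepos : 0 < e := by positivity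
  have hf : Summable (fun n : ℕ => (n : ℝ) ^ (-(1 + e))) :=
    Real.summable_nat_rpow.2 (by linarith)
  have hS := (summable_prod_fin hf (fun n => by positivity) (m + 1)).comp_injective
    (i := fun k : DecreasingTuple (m + 1) => k.1) Subtype.val_injective
  refine Summable.of_nonneg_of_le (fun k => ?_) (fun k => ?_) hS
  · unfold multipleZetaTerm
    positivity
  obtain ⟨k, hk, hpos⟩ := k
  have hone : ∀ i, (1 : ℝ) ≤ k i := fun i => by exact_mod_cast hpos i
  have hp : ∀ i, (0 : ℝ) < k i := fun i => by exact_mod_cast hpos i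
  have hle : ∀ i, (k i : ℝ) ≤ k 0 := fun i => by
    exact_mod_cast hk.antitone (Fin.zero_le i)
  simp only [multipleZetaTerm, Function.comp]
  rw [one_div, ← Finset.prod_inv_distrib, Fin.prod_univ_succ, Fin.prod_univ_succ]
  have hA : ((k 0 : ℝ) ^ s 0)⁻¹ ≤ (k 0 : ℝ) ^ (-2 : ℝ) := by
    rw [← Real.rpow_natCast, ← Real.rpow_neg (hp 0).le]
    refine Real.rpow_le_rpow_of_exponent_le (hone 0) ?_
    have : (2 : ℝ) ≤ s 0 := by exact_mod_cast h2
    linarith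
  have hB : ∀ i : Fin m, ((k i.succ : ℝ) ^ s i.succ)⁻¹ ≤
      (k 0 : ℝ) ^ e * (k i.succ : ℝ) ^ (-(1 + e)) := by
    intro i
    calc ((k i.succ : ℝ) ^ s i.succ)⁻¹ ≤ (k i.succ : ℝ) ^ (-1 : ℝ) := by
          rw [← Real.rpow_natCast, ← Real.rpow_neg (hp _).le]
          refine Real.rpow_le_rpow_of_exponent_le (hone _) ?_
          have : (1 : ℝ) ≤ s i.succ := by exact_mod_cast h1 i.succ
          linarith
      _ = (k i.succ : ℝ) ^ e * (k i.succ : ℝ) ^ (-(1 + e)) := by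
          rw [← Real.rpow_add (hp _)]
          congr 1
          ring
      _ ≤ _ := by
          gcongr
          exact_mod_cast hle i.succ
  calc _ ≤ (k 0 : ℝ) ^ (-2 : ℝ) *
        ∏ i : Fin m, ((k 0 : ℝ) ^ e * (k i.succ : ℝ) ^ (-(1 + e))) := by
        gcongr with i
        exact hB i
    _ = _ := by
        rw [Finset.prod_mul_distrib, Finset.prod_const, Finset.card_univ, Fintype.card_fin,
          ← mul_assoc, ← Real.rpow_natCast, ← Real.rpow_mul (hp 0).le, ← Real.rpow_add (hp 0)]
        congr 2
        rw [he]
        field_simp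
        ring

/-! For n ≥ 5 the identity comes from evaluating P = ∑ ζ(a) ∑ 2^j ζ(j,k), over a, j ≥ 2, k ≥ 1, a +
j + k = n, in two ways.

The inner sum is a weighted sum formula: ∑ 2^j ζ(j,k) = (w+1) ζ(w) in weight w
(`sum_two_pow_mul_multipleZeta`). Hence P = ∑ (b+1) ζ(a) ζ(b) over a + b = n, b ≥ 3. Once the term b
= 2 is added, the symmetry a ↔ b replaces b + 1 by its mean (n+2)/2, and ∑ ζ(a) ζ(b) is known.

Alternatively, the stuffle product expands ζ(a) ζ(j,k) into three triple and two double zeta values.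
The triple values give the weights 2^k and twice 2^j on the left side, up to boundary terms with an
argument 1. The boundary sum not already present in the theorem is ∑ ζ(j,1,k), evaluated by
`sum_zetaThree_one`.

The sum formulas rest on the partial fraction 1/(PQ) = 1/(P+Q) (1/P + 1/Q) and the telescoping of ∑
1/(P(P+Q)). Series are manipulated in [0,∞], where every rearrangement is legitimate; finiteness is
needed only to cancel terms and to return to the reals. -/

open Finset Filter Topology
open scoped ENNReal

/-! ### Reciprocals, partial fractions and telescoping -/

/-- The reciprocals `1 / (k + 1)` as extended nonnegative reals. -/
noncomputable def recip (k : ℕ) : ℝ≥0∞ := ((k + 1 : ℕ) : ℝ≥0∞)⁻¹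

theorem recip_ne_top (k : ℕ) : recip k ≠ ∞ := by simp [recip]

theorem recip_anti {a b : ℕ} (h : a ≤ b) : recip b ≤ recip a := by
  unfold recip
  gcongr

theorem recip_eq_ofReal (k : ℕ) : recip k = ENNReal.ofReal (1 / ((k + 1 : ℕ) : ℝ)) := by
  rw [recip, one_div, ENNReal.ofReal_inv_of_pos (by positivity), ENNReal.ofReal_natCast]

/-- The partial fraction identity `1/(PQ) = 1/(P+Q) (1/P + 1/Q)`. -/
theorem recip_mul_recip (p q : ℕ) :
    recip p * recip q = recip (p + q + 1) * (recip p + recip q) := by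
  simp only [recip_eq_ofReal]
  rw [← ENNReal.ofReal_add (by positivity) (by positivity),
    ← ENNReal.ofReal_mul (by positivity), ← ENNReal.ofReal_mul (by positivity)]
  congr 1
  push_cast
  field_simp
  ring

theorem tendsto_recip : Tendsto recip atTop (𝓝 0) :=
  (tendsto_add_atTop_iff_nat 1).2 ENNReal.tendsto_inv_nat_nhds_zero

/-- Partial sums of the telescoping series `∑ 1/(k(k+Q)) = 1/Q ∑ (1/k - 1/(k+Q))`. -/
theorem sum_recip_mul_recip_add (m q M : ℕ) :
    ∑ i ∈ range M, recip (i + m + q + 1) * recip (i + m)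
      + recip q * ∑ i ∈ range (q + 1), recip (M + m + i)
      = recip q * ∑ i ∈ range (q + 1), recip (m + i) := by
  induction M with
  | zero => simp
  | succ M ih =>
    rw [← ih, sum_range_succ, sum_range_succ (fun i => recip (M + 1 + m + i)),
      sum_range_succ' (fun i => recip (M + m + i))]
    have h : ∀ i, M + 1 + m + i = M + m + (i + 1) := fun i => by ring
    simp only [h, add_zero]
    have e : recip q * recip (M + m)
        = recip (M + m + q + 1) * recip (M + m) + recip q * recip (M + m + q + 1) := by
      rw [mul_comm, recip_mul_recip]
      ring
    rw [show M + m + (q + 1) = M + m + q + 1 by ring, mul_add _ _ (recip (M + m)), e]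
    ring

theorem tsum_recip_mul_recip_add (m q : ℕ) :
    ∑' i, recip (i + m + q + 1) * recip (i + m)
      = recip q * ∑ i ∈ range (q + 1), recip (m + i) := by
  have h0 : Tendsto (fun M => recip q * ∑ i ∈ range (q + 1), recip (M + m + i)) atTop (𝓝 0) := by
    have : Tendsto (fun M => ∑ i ∈ range (q + 1), recip (M + m + i)) atTop
        (𝓝 (∑ i ∈ range (q + 1), 0)) := by
      refine tendsto_finsetSum _ fun i _ => ?_
      simp only [add_assoc]
      exact (tendsto_add_atTop_iff_nat (m + i)).2 tendsto_recip
    simpa using ENNReal.Tendsto.const_mul this (Or.inr (recip_ne_top q))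
  have h1 := (ENNReal.tendsto_nat_tsum
    (fun i => recip (i + m + q + 1) * recip (i + m))).add h0
  simp only [sum_recip_mul_recip_add, add_zero] at h1
  exact (tendsto_nhds_unique tendsto_const_nhds h1).symm

/-! ### Nested sums in [0,∞], zeta values and stuffle products -/

/-- Tonelli: sum over the smaller index first, with the gap `p = a - b - 1` as the second variable.
-/
theorem tsum_sum_range_eq (F : ℕ → ℕ → ℝ≥0∞) :
    ∑' a, ∑ b ∈ range a, F a b = ∑' b, ∑' p, F (b + p + 1) b := by
  have h : ∀ a, ∑ b ∈ range a, F a b = ∑' b, if b < a then F a b else 0 := by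
    intro a
    rw [tsum_eq_sum (s := range a) (fun b hb => by simp_all)]
    exact sum_congr rfl fun b hb => by simp_all
  simp_rw [h]
  rw [ENNReal.tsum_comm]
  refine tsum_congr fun b => ?_
  have hi : Function.Injective fun p : ℕ => b + p + 1 := fun p q hpq => by simpa using hpq
  rw [← hi.tsum_eq]
  · exact tsum_congr fun p => by rw [if_pos (by omega)]
  · intro a ha
    have : b < a := by
      by_contra hn
      simp [hn] at ha
    exact ⟨a - b - 1, by simp only; omega⟩

theorem tsum_sum_range_sum_range_eq (F : ℕ → ℕ → ℕ → ℝ≥0∞) :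
    ∑' a, ∑ b ∈ range a, ∑ c ∈ range b, F a b c
      = ∑' c, ∑' p, ∑' q, F (c + p + q + 2) (c + p + 1) c := by
  rw [tsum_sum_range_eq (fun a b => ∑ c ∈ range b, F a b c)]
  have : ∀ b, ∑' p, ∑ c ∈ range b, F (b + p + 1) b c = ∑ c ∈ range b, ∑' p, F (b + p + 1) b c :=
    fun b => Summable.tsum_finsetSum fun _ _ => ENNReal.summable
  simp_rw [this]
  rw [tsum_sum_range_eq (fun b c => ∑' p, F (b + p + 1) b c)]
  refine tsum_congr fun c => tsum_congr fun p => tsum_congr fun q => ?_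
  rw [show c + p + 1 + q + 1 = c + p + q + 2 by ring]

/-- The zeta value `ζ(s)` as an extended nonnegative real. -/
noncomputable def zetaOne (s : ℕ) : ℝ≥0∞ := ∑' a, recip a ^ s

/-- The double zeta value `ζ(s, t)` as an extended nonnegative real. -/
noncomputable def zetaTwo (s t : ℕ) : ℝ≥0∞ :=
  ∑' a, ∑ b ∈ range a, recip a ^ s * recip b ^ t

/-- The triple zeta value `ζ(s, t, r)` as an extended nonnegative real. -/
noncomputable def zetaThree (s t r : ℕ) : ℝ≥0∞ :=
  ∑' a, ∑ b ∈ range a, ∑ c ∈ range b, recip a ^ s * recip b ^ t * recip c ^ r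

theorem zetaTwo_eq (s t : ℕ) :
    zetaTwo s t = ∑' q, ∑' p, recip (q + p + 1) ^ s * recip q ^ t :=
  tsum_sum_range_eq fun a b => recip a ^ s * recip b ^ t

theorem zetaThree_eq (s t r : ℕ) :
    zetaThree s t r =
      ∑' c, ∑' p, ∑' q, recip (c + p + q + 2) ^ s * recip (c + p + 1) ^ t * recip c ^ r :=
  tsum_sum_range_sum_range_eq fun a b c => recip a ^ s * recip b ^ t * recip c ^ r

theorem sum_range_mul_sum_range {R : Type*} [CommSemiring R] (f g : ℕ → R) (n : ℕ) :
    (∑ k ∈ range n, f k) * ∑ k ∈ range n, g k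
      = ∑ k ∈ range n, f k * g k + ∑ k ∈ range n, g k * ∑ i ∈ range k, f i
        + ∑ k ∈ range n, f k * ∑ i ∈ range k, g i := by
  induction n with
  | zero => simp
  | succ n ih =>
    simp only [sum_range_succ]
    rw [add_mul, mul_add, ih]
    ring

/-- Index pairs are split into the diagonal and the two strict orders; this is the source of the
stuffle product. -/
theorem tsum_mul_tsum_eq (f g : ℕ → ℝ≥0∞) :
    (∑' k, f k) * ∑' k, g k
      = ∑' k, f k * g k + ∑' k, g k * ∑ i ∈ range k, f i
        + ∑' k, f k * ∑ i ∈ range k, g i := by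
  have h : ∀ k, f k * ∑' a, g a
      = f k * g k + (f k * ∑ i ∈ range k, g i + ∑' p, g (k + p + 1) * f k) := by
    intro k
    rw [← (ENNReal.summable (f := fun n => g (n + (k + 1)))).sum_add_tsum_nat_add',
      sum_range_succ, ENNReal.tsum_mul_right]
    have : ∀ p, k + p + 1 = p + (k + 1) := fun p => by ring
    simp only [this]
    ring
  rw [← ENNReal.tsum_mul_right]
  simp_rw [h]
  rw [ENNReal.tsum_add, ENNReal.tsum_add, ← tsum_sum_range_eq (fun a b => g a * f b)]
  simp_rw [mul_sum]
  ring

theorem zetaOne_mul_zetaOne (s t : ℕ) :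
    zetaOne s * zetaOne t = zetaOne (s + t) + zetaTwo t s + zetaTwo s t := by
  unfold zetaOne zetaTwo
  rw [tsum_mul_tsum_eq]
  simp_rw [mul_sum, pow_add]

/-- The new index either lies above, between or below the two old ones, or coincides with one of
them. -/
theorem zetaOne_mul_zetaTwo (s t r : ℕ) :
    zetaOne s * zetaTwo t r = zetaThree s t r + zetaThree t s r + zetaThree t r s
      + zetaTwo (s + t) r + zetaTwo t (s + r) := by
  unfold zetaOne zetaTwo zetaThree
  simp_rw [← mul_sum, mul_assoc, ← mul_sum]
  rw [tsum_mul_tsum_eq]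
  have h : ∀ k, (recip k ^ t * ∑ i ∈ range k, recip i ^ r) * ∑ i ∈ range k, recip i ^ s
      = recip k ^ t * ∑ b ∈ range k, recip b ^ (s + r)
        + recip k ^ t * ∑ b ∈ range k, recip b ^ s * ∑ c ∈ range b, recip c ^ r
        + recip k ^ t * ∑ b ∈ range k, recip b ^ r * ∑ c ∈ range b, recip c ^ s := by
    intro k
    rw [mul_assoc, sum_range_mul_sum_range]
    simp_rw [pow_add]
    simp only [mul_comm (recip _ ^ s) (recip _ ^ r)]
    ring
  simp_rw [h, ENNReal.tsum_add, pow_add, mul_assoc]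
  ring

/-! ### Comparison with the real multiple zeta values -/

def decreasingTupleOneEquiv : ℕ ≃ DecreasingTuple 1 where
  toFun a := ⟨![a + 1], by intro i j h; omega, by intro i; simp⟩
  invFun k := k.1 0 - 1
  left_inv a := by simp
  right_inv k := by
    have h := k.2.2 0
    apply Subtype.ext
    funext i
    fin_cases i
    simp
    omega

/-- The coordinates are the smallest index and the gap, each lowered by 1, matching `zetaTwo_eq`. -/
def decreasingTupleTwoEquiv : ℕ × ℕ ≃ DecreasingTuple 2 where
  toFun x := ⟨![x.1 + x.2 + 2, x.1 + 1], by
    refine Fin.strictAnti_iff_succ_lt.2 fun i => ?_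
    fin_cases i
    simp, by intro i; fin_cases i <;> simp⟩
  invFun k := (k.1 1 - 1, k.1 0 - k.1 1 - 1)
  left_inv a := by
    apply Prod.ext <;> simp <;> omega
  right_inv k := by
    have h1 := k.2.2 1
    have h := k.2.1 (show (0 : Fin 2) < 1 by decide)
    apply Subtype.ext
    funext i
    fin_cases i <;> simp <;> omega

def decreasingTupleThreeEquiv : ℕ × ℕ × ℕ ≃ DecreasingTuple 3 where
  toFun x := ⟨![x.1 + x.2.1 + x.2.2 + 3, x.1 + x.2.1 + 2, x.1 + 1], by
    refine Fin.strictAnti_iff_succ_lt.2 fun i => ?_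
    fin_cases i <;> simp, by intro i; fin_cases i <;> simp⟩
  invFun k := (k.1 2 - 1, k.1 1 - k.1 2 - 1, k.1 0 - k.1 1 - 1)
  left_inv a := by
    refine Prod.ext ?_ (Prod.ext ?_ ?_) <;> simp <;> omega
  right_inv k := by
    have h1 := k.2.2 2
    have h := k.2.1 (show (0 : Fin 3) < 1 by decide)
    have h' := k.2.1 (show (1 : Fin 3) < 2 by decide)
    apply Subtype.ext
    funext i
    fin_cases i <;> simp <;> omega

theorem ofReal_multipleZetaTerm {d : ℕ} (s : Fin d → ℕ) (k : DecreasingTuple d) :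
    ENNReal.ofReal (multipleZetaTerm s k) = ∏ i, recip (k.1 i - 1) ^ s i := by
  rw [multipleZetaTerm, one_div, ← prod_inv_distrib,
    ENNReal.ofReal_prod_of_nonneg fun i _ => by positivity]
  refine prod_congr rfl fun i _ => ?_
  rw [recip_eq_ofReal, Nat.sub_add_cancel (k.2.2 i), ← ENNReal.ofReal_pow (by positivity),
    one_div, inv_pow]

theorem ofReal_multipleZeta {m : ℕ} (s : Fin (m + 1) → ℕ) (h2 : 2 ≤ s 0) (h1 : ∀ i, 1 ≤ s i) :
    ENNReal.ofReal (multipleZeta s)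
      = ∑' k : DecreasingTuple (m + 1), ∏ i, recip (k.1 i - 1) ^ s i := by
  rw [multipleZeta, ENNReal.ofReal_tsum_of_nonneg
    (fun k => by unfold multipleZetaTerm; positivity) (summable_multipleZetaTerm s h2 h1)]
  exact tsum_congr fun k => ofReal_multipleZetaTerm s k

theorem zetaOne_eq_ofReal (s : ℕ) (hs : 2 ≤ s) :
    zetaOne s = ENNReal.ofReal (multipleZeta ![s]) := by
  rw [ofReal_multipleZeta _ (by simpa) (by intro i; fin_cases i; simp; omega),
    ← decreasingTupleOneEquiv.tsum_eq]
  simp [decreasingTupleOneEquiv, zetaOne]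
  rfl

theorem zetaTwo_eq_ofReal (s t : ℕ) (hs : 2 ≤ s) (ht : 1 ≤ t) :
    zetaTwo s t = ENNReal.ofReal (multipleZeta ![s, t]) := by
  rw [ofReal_multipleZeta _ (by simpa) (by intro i; fin_cases i <;> simp <;> omega),
    ← decreasingTupleTwoEquiv.tsum_eq, ENNReal.tsum_prod', zetaTwo_eq]
  simp [decreasingTupleTwoEquiv, Fin.prod_univ_succ]
  rfl

theorem zetaThree_eq_ofReal (s t r : ℕ) (hs : 2 ≤ s) (ht : 1 ≤ t) (hr : 1 ≤ r) :
    zetaThree s t r = ENNReal.ofReal (multipleZeta ![s, t, r]) := by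
  rw [ofReal_multipleZeta _ (by simpa) (by intro i; fin_cases i <;> simp <;> omega),
    ← decreasingTupleThreeEquiv.tsum_eq, ENNReal.tsum_prod', zetaThree_eq]
  simp_rw [ENNReal.tsum_prod']
  simp [decreasingTupleThreeEquiv, Fin.prod_univ_succ, mul_assoc]
  rfl

theorem zetaTwo_ne_top (s t : ℕ) : zetaTwo (s + 2) (t + 1) ≠ ∞ := by
  rw [zetaTwo_eq_ofReal _ _ (by omega) (by omega)]
  exact ENNReal.ofReal_ne_top

theorem zetaThree_ne_top (s t r : ℕ) : zetaThree (s + 2) (t + 1) (r + 1) ≠ ∞ := by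
  rw [zetaThree_eq_ofReal _ _ _ (by omega) (by omega) (by omega)]
  exact ENNReal.ofReal_ne_top

/-! ### Algebraic identities from the partial fraction relation -/

/-- If `1/u + 1/v = 1/w`, the geometric sum `∑ w ^ j v ^ (n - j)`, written without division. -/
theorem sum_antidiagonal_pow_mul_pow {R : Type*} [CommSemiring R] {u v w : R}
    (h : u * v = w * (u + v)) (m : ℕ) :
    ∑ x ∈ antidiagonal m, w ^ (x.1 + 2) * v ^ (x.2 + 1) + w ^ (m + 2) * u
      = v ^ (m + 1) * (w * u) := by
  induction m with
  | zero =>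
    simp only [Nat.antidiagonal_zero, sum_singleton, zero_add, pow_one]
    rw [show v * (w * u) = w * (u * v) by ring, h]
    ring
  | succ m ih =>
    rw [Nat.sum_antidiagonal_succ']
    have : ∀ x : ℕ × ℕ, w ^ (x.1 + 2) * v ^ (x.2 + 1 + 1) = v * (w ^ (x.1 + 2) * v ^ (x.2 + 1)) :=
      fun x => by ring
    simp only [this, ← mul_sum]
    calc _ = v * ∑ x ∈ antidiagonal m, w ^ (x.1 + 2) * v ^ (x.2 + 1)
          + w ^ (m + 2) * (w * (u + v)) := by ring
      _ = v * (∑ x ∈ antidiagonal m, w ^ (x.1 + 2) * v ^ (x.2 + 1) + w ^ (m + 2) * u) := by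
        rw [← h]
        ring
      _ = _ := by
        rw [ih]
        ring

/-- If `1/u + 1/v = 1/w`, the sum `∑ u ^ a v ^ b` over `a + b = n` as a polynomial in `w` with
coefficients `u ^ k + v ^ k`. -/
theorem sum_antidiagonal_shuffle {R : Type*} [CommSemiring R] {u v w : R}
    (h : u * v = w * (u + v)) (m : ℕ) :
    ∑ x ∈ antidiagonal m, u ^ (x.1 + 1) * v ^ (x.2 + 1)
      = ∑ x ∈ antidiagonal m, 2 ^ x.1 * w ^ (x.1 + 1) * (u ^ (x.2 + 1) + v ^ (x.2 + 1)) := by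
  induction m with
  | zero => simpa using h
  | succ m ih =>
    rw [Nat.sum_antidiagonal_succ
      (f := fun x : ℕ × ℕ => 2 ^ x.1 * w ^ (x.1 + 1) * (u ^ (x.2 + 1) + v ^ (x.2 + 1)))]
    have e1 : ∀ x : ℕ × ℕ, 2 ^ (x.1 + 1) * w ^ (x.1 + 1 + 1) * (u ^ (x.2 + 1) + v ^ (x.2 + 1))
        = 2 * w * (2 ^ x.1 * w ^ (x.1 + 1) * (u ^ (x.2 + 1) + v ^ (x.2 + 1))) := fun x => by ring
    simp only [e1, ← mul_sum, ← ih]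
    have e2 : ∀ x : ℕ × ℕ, u ^ (x.1 + 1) * v ^ (x.2 + 1) =
        w * (u ^ (x.1 + 1) * v ^ x.2 + u ^ x.1 * v ^ (x.2 + 1)) := fun x => by
      calc _ = u ^ x.1 * v ^ x.2 * (u * v) := by ring
        _ = _ := by
          rw [h]
          ring
    rw [sum_congr rfl fun x _ => e2 x, ← mul_sum, sum_add_distrib,
      Nat.sum_antidiagonal_succ' (f := fun x : ℕ × ℕ => u ^ (x.1 + 1) * v ^ x.2),
      Nat.sum_antidiagonal_succ (f := fun x : ℕ × ℕ => u ^ x.1 * v ^ (x.2 + 1))]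
    ring

/-- With u = 1/P, v = 1/Q, w = 1/(P+Q), the end terms u v^(m+3) and v u^(m+3) of
`sum_antidiagonal_shuffle` have divergent double series. Both sides contain w (u^(m+3) + v^(m+3)),
as u v = w (u + v) shows; cancelling it leaves convergent series. -/
theorem sum_antidiagonal_shuffle_regularized {u v w : ℝ≥0∞} (hu : u ≠ ∞) (hv : v ≠ ∞)
    (hw : w ≠ ∞) (h : u * v = w * (u + v)) (m : ℕ) :
    ∑ x ∈ antidiagonal m, u ^ (x.1 + 2) * v ^ (x.2 + 2)
        + (w * u * v ^ (m + 2) + w * v * u ^ (m + 2))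
      = ∑ x ∈ antidiagonal (m + 1),
        2 ^ (x.1 + 1) * (w ^ (x.1 + 2) * u ^ (x.2 + 1) + w ^ (x.1 + 2) * v ^ (x.2 + 1)) := by
  have key := sum_antidiagonal_shuffle h (m + 2)
  rw [Nat.sum_antidiagonal_succ, Nat.sum_antidiagonal_succ', Nat.sum_antidiagonal_succ] at key
  have hfin : w * (u ^ (m + 3) + v ^ (m + 3)) ≠ ∞ :=
    ENNReal.mul_ne_top hw (ENNReal.add_ne_top.2 ⟨ENNReal.pow_ne_top hu, ENNReal.pow_ne_top hv⟩)
  rw [← ENNReal.add_right_inj hfin]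
  have e1 : u * v ^ (m + 3) = w * v ^ (m + 3) + w * u * v ^ (m + 2) := by
    rw [show u * v ^ (m + 3) = v ^ (m + 2) * (u * v) by ring, h]
    ring
  have e2 : v * u ^ (m + 3) = w * u ^ (m + 3) + w * v * u ^ (m + 2) := by
    rw [show v * u ^ (m + 3) = u ^ (m + 2) * (u * v) by ring, h]
    ring
  simp only [zero_add, pow_zero, pow_one, one_mul, add_assoc] at key
  norm_num only at key
  have e3 : ∀ x : ℕ × ℕ,
      2 ^ (x.1 + 1) * (w ^ (x.1 + 2) * u ^ (x.2 + 1) + w ^ (x.1 + 2) * v ^ (x.2 + 1))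
      = 2 ^ (x.1 + 1) * (w ^ (x.1 + 2) * (u ^ (x.2 + 1) + v ^ (x.2 + 1))) := fun x => by ring
  simp only [e3]
  simp only [mul_assoc] at key ⊢
  rw [← key]
  rw [e1, mul_comm (u ^ (m + 3)) v, e2]
  ring

/-! ### Sum formula and summed shuffle relations in depth two -/

theorem tsum_tsum_congr {f g : ℕ → ℕ → ℝ≥0∞} (h : ∀ a b, f a b = g a b) :
    ∑' a, ∑' b, f a b = ∑' a, ∑' b, g a b := by
  simp_rw [h]

theorem tsum_tsum_tsum_congr {f g : ℕ → ℕ → ℕ → ℝ≥0∞} (h : ∀ a b c, f a b c = g a b c) :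
    ∑' a, ∑' b, ∑' c, f a b c = ∑' a, ∑' b, ∑' c, g a b c := by
  simp_rw [h]

/-- With Q = q + 1, the inner series telescopes to H_Q / Q for the harmonic number H_Q; the last
term 1/Q of H_Q yields the single zeta value. -/
theorem tsum_recip_mul_recip_mul_pow (s : ℕ) :
    ∑' q, ∑' p, recip (q + p + 1) * recip p * recip q ^ s
      = zetaTwo (s + 1) 1 + zetaOne (s + 2) := by
  have h : ∀ q, ∑' p, recip (q + p + 1) * recip p * recip q ^ s
      = ∑ b ∈ range q, recip q ^ (s + 1) * recip b ^ 1 + recip q ^ (s + 2) := by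
    intro q
    rw [ENNReal.tsum_mul_right]
    have := tsum_recip_mul_recip_add 0 q
    simp only [add_zero, zero_add] at this
    have e : ∀ p, q + p + 1 = p + q + 1 := fun p => by ring
    simp only [e, this, sum_range_succ, pow_one, ← mul_sum]
    ring
  simp_rw [h]
  rw [ENNReal.tsum_add]
  rfl

theorem recip_shuffle (q p : ℕ) :
    recip p * recip q = recip (q + p + 1) * (recip p + recip q) := by
  rw [add_comm q, recip_mul_recip]

theorem zetaTwo_eq' (s t : ℕ) :
    zetaTwo s t = ∑' q, ∑' p, recip (q + p + 1) ^ s * recip p ^ t := by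
  rw [zetaTwo_eq, ENNReal.tsum_comm]
  simp_rw [add_comm]

/-- The sum formula in depth two. -/
theorem sum_zetaTwo (m : ℕ) :
    ∑ x ∈ antidiagonal m, zetaTwo (x.1 + 2) (x.2 + 1) = zetaOne (m + 3) := by
  have h := tsum_tsum_congr fun q p =>
    sum_antidiagonal_pow_mul_pow (recip_shuffle q p) m
  simp_rw [ENNReal.tsum_add, Summable.tsum_finsetSum fun _ _ => ENNReal.summable] at h
  have e := tsum_recip_mul_recip_mul_pow (m + 1)
  simp_rw [mul_comm _ (recip _ ^ (m + 1))] at e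
  rw [e] at h
  simp_rw [← zetaTwo_eq] at h
  have e' := zetaTwo_eq' (m + 2) 1
  simp only [pow_one] at e'
  rw [← e', add_comm] at h
  exact (ENNReal.add_right_inj (zetaTwo_ne_top m 0)).1 h

/-- The shuffle relations of weight `m + 4`, summed. -/
theorem sum_zetaOne_mul_zetaOne_add (m : ℕ) :
    ∑ x ∈ antidiagonal m, zetaOne (x.1 + 2) * zetaOne (x.2 + 2)
        + 2 * (zetaTwo (m + 3) 1 + zetaOne (m + 4))
      = ∑ x ∈ antidiagonal (m + 1), 2 ^ (x.1 + 2) * zetaTwo (x.1 + 2) (x.2 + 1) := by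
  have h := tsum_tsum_congr fun q p =>
    sum_antidiagonal_shuffle_regularized (recip_ne_top p) (recip_ne_top q) (recip_ne_top _)
      (recip_shuffle q p) m
  simp_rw [ENNReal.tsum_add, Summable.tsum_finsetSum fun _ _ => ENNReal.summable,
    ENNReal.tsum_mul_left, ENNReal.tsum_add] at h
  simp_rw [← zetaTwo_eq, ← zetaTwo_eq'] at h
  have e1 := tsum_recip_mul_recip_mul_pow (m + 2)
  have e2 : ∑' q, ∑' p, recip (q + p + 1) * recip q * recip p ^ (m + 2)
      = zetaTwo (m + 3) 1 + zetaOne (m + 4) := by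
    rw [ENNReal.tsum_comm]
    simp_rw [← e1, add_comm]
  rw [e1, e2] at h
  simp_rw [ENNReal.tsum_mul_right, ENNReal.tsum_mul_left] at h
  rw [two_mul]
  refine h.trans (sum_congr rfl fun x _ => ?_)
  ring

/-! ### Triple zeta values with middle argument 1 -/

/-- For indices K₁ > K₂ > K₃, the geometric sum is applied with u = 1/(K₁ - K₃), v = 1/K₃, w = 1/K₁
and multiplied by 1/K₂. On the right the sum over K₁ > K₂ of 1/(K₁ (K₁ - K₃)) telescopes. The second
series on the left is an error term that later cancels. -/
theorem sum_zetaThree_add (m : ℕ) :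
    ∑ x ∈ antidiagonal m, zetaThree (x.1 + 2) 1 (x.2 + 1)
      + ∑' c, ∑' p, ∑' q, recip (c + p + q + 2) ^ (m + 2) * recip (p + q + 1) * recip (c + p + 1)
      = ∑' c, recip c ^ (m + 2) * ∑' p, recip (c + p + 1) * ∑ i ∈ range (c + 1), recip (p + 1 + i)
      := by
  have h : ∀ c p q, ∑ x ∈ antidiagonal m,
        recip (c + p + q + 2) ^ (x.1 + 2) * recip (c + p + 1) ^ 1 * recip c ^ (x.2 + 1)
        + recip (c + p + q + 2) ^ (m + 2) * recip (p + q + 1) * recip (c + p + 1)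
      = recip c ^ (m + 1) * (recip (c + p + 1) *
        (recip (q + (p + 1) + c + 1) * recip (q + (p + 1)))) := by
    intro c p q
    have e := sum_antidiagonal_pow_mul_pow (recip_mul_recip (p + q + 1) c) m
    rw [show p + q + 1 + c + 1 = c + p + q + 2 by ring] at e
    rw [show q + (p + 1) + c + 1 = c + p + q + 2 by ring, show q + (p + 1) = p + q + 1 by ring]
    have e' : ∀ x : ℕ × ℕ,
        recip (c + p + q + 2) ^ (x.1 + 2) * recip (c + p + 1) ^ 1 * recip c ^ (x.2 + 1)
        = recip (c + p + 1) * (recip (c + p + q + 2) ^ (x.1 + 2) * recip c ^ (x.2 + 1)) :=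
      fun x => by ring
    simp only [e', ← mul_sum]
    calc _ = recip (c + p + 1) * (∑ x ∈ antidiagonal m,
          recip (c + p + q + 2) ^ (x.1 + 2) * recip c ^ (x.2 + 1)
          + recip (c + p + q + 2) ^ (m + 2) * recip (p + q + 1)) := by ring
      _ = _ := by
        rw [e]
        ring
  have h' := tsum_tsum_tsum_congr h
  simp_rw [ENNReal.tsum_add, Summable.tsum_finsetSum fun _ _ => ENNReal.summable,
    ENNReal.tsum_mul_left, tsum_recip_mul_recip_add, ← zetaThree_eq] at h'
  rw [h']
  refine tsum_congr fun c => ?_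
  rw [← ENNReal.tsum_mul_left, ← ENNReal.tsum_mul_left]
  exact tsum_congr fun p => by ring

/-- The term `i = c` of the inner sum gives the squares. Each other term, indexed by `t = c - 1 -
i`, telescopes in `p` to `recip t` times a block of `t + 1` reciprocals, whose last member is `recip
c`. After weighting by `recip c ^ (m + 2)` the three parts become ζ(2,m+2), ζ(m+3,1) and the error
term. -/
theorem tsum_recip_mul_sum_recip (c : ℕ) :
    ∑' p, recip (c + p + 1) * ∑ i ∈ range (c + 1), recip (p + 1 + i)
      = ∑' p, recip (c + p + 1) ^ 2 + recip c * ∑ t ∈ range c, recip t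
        + ∑ t ∈ range c, ∑ s ∈ range t, recip t * recip (c - t + s) := by
  have h : ∀ p, recip (c + p + 1) * ∑ i ∈ range (c + 1), recip (p + 1 + i)
      = recip (c + p + 1) ^ 2
        + ∑ t ∈ range c, recip (p + (c - t) + t + 1) * recip (p + (c - t)) := by
    intro p
    rw [sum_range_succ, ← sum_range_reflect, mul_add, mul_sum, add_comm]
    congr 1
    · rw [show p + 1 + c = c + p + 1 by ring]
      ring
    · refine sum_congr rfl fun t ht => ?_
      have := mem_range.1 ht
      congr 2 <;> omega
  simp_rw [h]
  rw [ENNReal.tsum_add, Summable.tsum_finsetSum fun _ _ => ENNReal.summable]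
  simp_rw [tsum_recip_mul_recip_add]
  rw [add_assoc, mul_sum, ← sum_add_distrib]
  congr 1
  refine sum_congr rfl fun t ht => ?_
  have := mem_range.1 ht
  rw [sum_range_succ, show c - t + t = c by omega, mul_add, mul_sum]
  ring

/-- The sum formula restricted to middle argument `1`. -/
theorem sum_zetaThree_one (m : ℕ) :
    ∑ x ∈ antidiagonal m, zetaThree (x.1 + 2) 1 (x.2 + 1)
      = zetaTwo 2 (m + 2) + zetaTwo (m + 3) 1 := by
  have h := sum_zetaThree_add m
  set E := ∑' a, ∑ t ∈ range a, ∑ s ∈ range t, recip a ^ (m + 2) * recip (a - t + s) * recip t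
    with hE
  have e1 : ∑' c, ∑' p, ∑' q,
      recip (c + p + q + 2) ^ (m + 2) * recip (p + q + 1) * recip (c + p + 1) = E := by
    -- Exchanging `c` and `p` is the reflection K₃ ↦ K₂ - K₃ with K₁ and K₂ fixed, which turns K₁ -
    -- K₃ into K₁ - K₂ + K₃.
    rw [hE, tsum_sum_range_sum_range_eq
      (fun a t s => recip a ^ (m + 2) * recip (a - t + s) * recip t), ENNReal.tsum_comm]
    refine tsum_congr fun c => tsum_congr fun p => tsum_congr fun q => ?_
    rw [show p + c = c + p by ring, show c + p + q + 2 - (c + p + 1) + c = c + q + 1 by omega]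
  have e2 : ∑' c, recip c ^ (m + 2) *
      ∑' p, recip (c + p + 1) * ∑ i ∈ range (c + 1), recip (p + 1 + i)
      = zetaTwo 2 (m + 2) + zetaTwo (m + 3) 1 + E := by
    simp_rw [tsum_recip_mul_sum_recip, mul_add]
    rw [ENNReal.tsum_add, ENNReal.tsum_add, zetaTwo_eq]
    simp_rw [← ENNReal.tsum_mul_left]
    unfold zetaTwo
    congr 1
    · congr 1
      · exact tsum_congr fun c => tsum_congr fun p => mul_comm _ _
      · refine tsum_congr fun c => ?_
        rw [mul_sum, mul_sum]
        exact sum_congr rfl fun t _ => by ring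
    · refine tsum_congr fun c => ?_
      simp_rw [mul_sum]
      exact sum_congr rfl fun t _ => sum_congr rfl fun s _ => by ring
  have hfin : E ≠ ∞ := by
    -- Since `s ≤ a - t + s`, the error term is dominated by ζ(m+2,1,1).
    refine ne_top_of_le_ne_top (zetaThree_ne_top m 0 0) ?_
    refine ENNReal.tsum_le_tsum fun a => sum_le_sum fun t _ => sum_le_sum fun s _ => ?_
    rw [mul_right_comm, zero_add, pow_one, pow_one]
    gcongr
    exact recip_anti (by omega)
  rw [e1, e2] at h
  exact (ENNReal.add_left_inj hfin).1 h

/-! ### Transfer to the reals and weighted sums in depth two -/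

theorem multipleZeta_nonneg {d : ℕ} (s : Fin d → ℕ) : 0 ≤ multipleZeta s :=
  tsum_nonneg fun k => by unfold multipleZetaTerm; positivity

theorem toReal_zetaOne (s : ℕ) : (zetaOne (s + 2)).toReal = multipleZeta ![s + 2] := by
  rw [zetaOne_eq_ofReal _ (by omega), ENNReal.toReal_ofReal (multipleZeta_nonneg _)]

theorem toReal_zetaTwo (s t : ℕ) :
    (zetaTwo (s + 2) (t + 1)).toReal = multipleZeta ![s + 2, t + 1] := by
  rw [zetaTwo_eq_ofReal _ _ (by omega) (by omega), ENNReal.toReal_ofReal (multipleZeta_nonneg _)]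

theorem toReal_zetaThree (s t r : ℕ) :
    (zetaThree (s + 2) (t + 1) (r + 1)).toReal = multipleZeta ![s + 2, t + 1, r + 1] := by
  rw [zetaThree_eq_ofReal _ _ _ (by omega) (by omega) (by omega),
    ENNReal.toReal_ofReal (multipleZeta_nonneg _)]

theorem zetaOne_ne_top (s : ℕ) : zetaOne (s + 2) ≠ ∞ := by
  rw [zetaOne_eq_ofReal _ (by omega)]
  exact ENNReal.ofReal_ne_top

/-- The stuffle product of two zeta values. -/
theorem multipleZeta_mul_multipleZeta_one (a b : ℕ) :
    multipleZeta ![a + 2] * multipleZeta ![b + 2]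
      = multipleZeta ![a + b + 4] + multipleZeta ![b + 2, a + 2]
        + multipleZeta ![a + 2, b + 2] := by
  have h := congrArg ENNReal.toReal (zetaOne_mul_zetaOne (a + 2) (b + 2))
  rw [show a + 2 + (b + 2) = a + b + 4 by ring, ENNReal.toReal_mul,
    ENNReal.toReal_add (ENNReal.add_ne_top.2 ⟨zetaOne_ne_top _, zetaTwo_ne_top _ _⟩)
      (zetaTwo_ne_top _ _), ENNReal.toReal_add (zetaOne_ne_top _) (zetaTwo_ne_top _ _)] at h
  simpa only [toReal_zetaOne, toReal_zetaTwo] using h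

/-- The stuffle product of a zeta value and a double zeta value. -/
theorem multipleZeta_mul_multipleZeta_two (a j k : ℕ) :
    multipleZeta ![a + 2] * multipleZeta ![j + 2, k + 1]
      = multipleZeta ![a + 2, j + 2, k + 1] + multipleZeta ![j + 2, a + 2, k + 1]
        + multipleZeta ![j + 2, k + 1, a + 2] + multipleZeta ![a + j + 4, k + 1]
        + multipleZeta ![j + 2, a + k + 3] := by
  have h := congrArg ENNReal.toReal (zetaOne_mul_zetaTwo (a + 2) (j + 2) (k + 1))
  have h1 := zetaThree_ne_top a (j + 1) k
  have h2 := zetaThree_ne_top j (a + 1) k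
  have h3 := zetaThree_ne_top j k (a + 1)
  have h4 := zetaTwo_ne_top (a + j + 2) k
  have h5 := zetaTwo_ne_top j (a + k + 2)
  rw [show a + 2 + (j + 2) = a + j + 2 + 2 by ring,
    show a + 2 + (k + 1) = a + k + 2 + 1 by ring, ENNReal.toReal_mul,
    ENNReal.toReal_add (by simp [h1, h2, h3, h4]) h5,
    ENNReal.toReal_add (by simp [h1, h2, h3]) h4,
    ENNReal.toReal_add (by simp [h1, h2]) h3,
    ENNReal.toReal_add h1 h2] at h
  simpa only [toReal_zetaOne, toReal_zetaTwo, toReal_zetaThree] using h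

theorem sum_multipleZeta_two (m : ℕ) :
    ∑ x ∈ antidiagonal m, multipleZeta ![x.1 + 2, x.2 + 1] = multipleZeta ![m + 3] := by
  have h := congrArg ENNReal.toReal (sum_zetaTwo m)
  rw [ENNReal.toReal_sum fun _ _ => zetaTwo_ne_top _ _] at h
  simpa only [toReal_zetaOne, toReal_zetaTwo] using h

theorem sum_multipleZeta_three_one (m : ℕ) :
    ∑ x ∈ antidiagonal m, multipleZeta ![x.1 + 2, 1, x.2 + 1]
      = multipleZeta ![2, m + 2] + multipleZeta ![m + 3, 1] := by
  have h := congrArg ENNReal.toReal (sum_zetaThree_one m)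
  rw [ENNReal.toReal_sum fun _ _ => zetaThree_ne_top _ 0 _,
    ENNReal.toReal_add (zetaTwo_ne_top 0 _) (zetaTwo_ne_top _ 0)] at h
  have e1 := fun s r => toReal_zetaThree s 0 r
  have e2 := fun t => toReal_zetaTwo 0 t
  have e3 := fun s => toReal_zetaTwo s 0
  simp only [zero_add] at e1 e2 e3
  simpa only [e1, e2, e3] using h

/-- By the stuffle product, each of the two double sums is the depth-two sum formula without its
term ζ(m+3,1). -/
theorem sum_multipleZeta_mul_multipleZeta (m : ℕ) :
    ∑ x ∈ antidiagonal m, multipleZeta ![x.1 + 2] * multipleZeta ![x.2 + 2]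
      = (m + 3) * multipleZeta ![m + 4] - 2 * multipleZeta ![m + 3, 1] := by
  have h := sum_multipleZeta_two (m + 1)
  rw [Nat.sum_antidiagonal_succ'] at h
  have e : ∀ x ∈ antidiagonal m, multipleZeta ![x.1 + 2] * multipleZeta ![x.2 + 2]
      = multipleZeta ![m + 4] + multipleZeta ![x.2 + 2, x.1 + 2]
        + multipleZeta ![x.1 + 2, x.2 + 2] := fun x hx => by
    rw [multipleZeta_mul_multipleZeta_one, mem_antidiagonal.1 hx]
  rw [sum_congr rfl e, sum_add_distrib, sum_add_distrib, sum_const, Nat.card_antidiagonal,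
    ← Nat.sum_antidiagonal_swap (f := fun x : ℕ × ℕ => multipleZeta ![x.1 + 2, x.2 + 2])]
  simp only [Prod.fst_swap, Prod.snd_swap, nsmul_eq_mul, zero_add, add_assoc] at h ⊢
  norm_num at h ⊢
  rw [← Nat.sum_antidiagonal_swap (f := fun x : ℕ × ℕ => multipleZeta ![x.1 + 2, x.2 + 2])] at h
  simp only [Prod.fst_swap, Prod.snd_swap] at h
  linear_combination 2 * h

/-- The weighted sum formula in depth two. -/
theorem sum_two_pow_mul_multipleZeta (m : ℕ) :
    ∑ x ∈ antidiagonal m, (2 : ℝ) ^ (x.1 + 2) * multipleZeta ![x.1 + 2, x.2 + 1]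
      = (m + 4) * multipleZeta ![m + 3] := by
  -- In weight 3 there is no product ζ(a) ζ(b) with a, b ≥ 2, and the claim is 4 ζ(2,1) = 4 ζ(3).
  obtain _ | m := m
  · have h := sum_multipleZeta_two 0
    simp only [Nat.antidiagonal_zero, sum_singleton] at h ⊢
    rw [h]
    norm_num
  have h := congrArg ENNReal.toReal (sum_zetaOne_mul_zetaOne_add m)
  have hf : ∀ x ∈ antidiagonal m, zetaOne (x.1 + 2) * zetaOne (x.2 + 2) ≠ ∞ := fun x _ =>
    ENNReal.mul_ne_top (zetaOne_ne_top _) (zetaOne_ne_top _)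
  have hp : ∀ k : ℕ, (2 : ℝ≥0∞) ^ k ≠ ∞ := fun k => ENNReal.pow_ne_top ENNReal.ofNat_ne_top
  have hz : zetaTwo (m + 3) 1 + zetaOne (m + 4) ≠ ∞ :=
    ENNReal.add_ne_top.2 ⟨zetaTwo_ne_top (m + 1) 0, zetaOne_ne_top _⟩
  rw [ENNReal.toReal_add (ENNReal.sum_ne_top.2 hf) (ENNReal.mul_ne_top ENNReal.ofNat_ne_top hz),
    ENNReal.toReal_sum hf, ENNReal.toReal_sum fun x _ =>
      ENNReal.mul_ne_top (hp _) (zetaTwo_ne_top _ _), ENNReal.toReal_mul,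
    ENNReal.toReal_add (zetaTwo_ne_top (m + 1) 0) (zetaOne_ne_top _)] at h
  have e3 := toReal_zetaTwo (m + 1) 0
  simp only [zero_add] at e3
  simp only [ENNReal.toReal_mul, ENNReal.toReal_pow, ENNReal.toReal_ofNat, toReal_zetaOne,
    toReal_zetaTwo, e3, sum_multipleZeta_mul_multipleZeta] at h
  rw [← h, show m + 1 + 3 = m + 4 by ring]
  push_cast
  ring

/-! ### Reindexing sums over compositions -/

theorem sum_antidiagonal_assoc {M : Type*} [AddCommMonoid M] (f : ℕ → ℕ → ℕ → M) (m : ℕ) :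
    ∑ x ∈ antidiagonal m, ∑ y ∈ antidiagonal x.2, f x.1 y.1 y.2
      = ∑ x ∈ antidiagonal m, ∑ y ∈ antidiagonal x.1, f y.1 y.2 x.2 := by
  rw [sum_sigma', sum_sigma']
  refine sum_nbij' (fun z => ⟨(z.1.1 + z.2.1, z.2.2), (z.1.1, z.2.1)⟩)
    (fun z => ⟨(z.2.1, z.2.2 + z.1.2), (z.2.2, z.1.2)⟩) ?_ ?_ ?_ ?_ ?_
  · rintro ⟨⟨a, b⟩, ⟨c, d⟩⟩ h
    simp only [mem_sigma, HasAntidiagonal.mem_antidiagonal] at h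
    obtain ⟨rfl, rfl⟩ := h
    simp [add_assoc]
  · rintro ⟨⟨a, b⟩, ⟨c, d⟩⟩ h
    simp only [mem_sigma, HasAntidiagonal.mem_antidiagonal] at h
    obtain ⟨rfl, rfl⟩ := h
    simp [add_assoc]
  · rintro ⟨⟨a, b⟩, ⟨c, d⟩⟩ h
    simp only [mem_sigma, HasAntidiagonal.mem_antidiagonal] at h
    obtain ⟨-, rfl⟩ := h
    rfl
  · rintro ⟨⟨a, b⟩, ⟨c, d⟩⟩ h
    simp only [mem_sigma, HasAntidiagonal.mem_antidiagonal] at h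
    obtain ⟨-, rfl⟩ := h
    rfl
  · rintro ⟨⟨a, b⟩, ⟨c, d⟩⟩ h
    rfl

theorem sum_antidiagonal_swap_right {M : Type*} [AddCommMonoid M] (f : ℕ → ℕ → ℕ → M) (m : ℕ) :
    ∑ x ∈ antidiagonal m, ∑ y ∈ antidiagonal x.2, f x.1 y.1 y.2
      = ∑ x ∈ antidiagonal m, ∑ y ∈ antidiagonal x.2, f x.1 y.2 y.1 :=
  sum_congr rfl fun x _ =>
    (Nat.sum_antidiagonal_swap (f := fun y : ℕ × ℕ => f x.1 y.1 y.2)).symm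

theorem sum_antidiagonal_swap_left {M : Type*} [AddCommMonoid M] (f : ℕ → ℕ → ℕ → M) (m : ℕ) :
    ∑ x ∈ antidiagonal m, ∑ y ∈ antidiagonal x.2, f x.1 y.1 y.2
      = ∑ x ∈ antidiagonal m, ∑ y ∈ antidiagonal x.2, f y.1 x.1 y.2 := by
  rw [sum_antidiagonal_assoc, sum_antidiagonal_assoc fun a b c => f b a c]
  exact sum_congr rfl fun x _ =>
    (Nat.sum_antidiagonal_swap (f := fun y : ℕ × ℕ => f y.1 y.2 x.2)).symm

theorem sum_antidiagonal_sum_succ {M : Type*} [AddCommMonoid M] (f : ℕ → ℕ → ℕ → M) (m : ℕ) :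
    ∑ x ∈ antidiagonal (m + 1), ∑ y ∈ antidiagonal x.2, f x.1 y.1 y.2
      = ∑ x ∈ antidiagonal (m + 1), f 0 x.1 x.2
        + ∑ x ∈ antidiagonal m, ∑ y ∈ antidiagonal x.2, f (x.1 + 1) y.1 y.2 := by
  rw [Nat.sum_antidiagonal_succ]

theorem sum_antidiagonal_two_pow (N : ℕ) :
    ∑ y ∈ antidiagonal N, (2 : ℝ) ^ (y.2 + 2) = 2 ^ (N + 3) - 4 := by
  induction N with
  | zero => norm_num
  | succ N ih =>
    rw [Nat.sum_antidiagonal_succ, ih]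
    ring

/-! ### The two evaluations of the product sum -/

/-- The symmetric evaluation of `∑ ζ(a) ∑ 2 ^ j ζ(j, k)`. -/
theorem sum_multipleZeta_mul_sum_two_pow (m : ℕ) :
    ∑ x ∈ antidiagonal m, multipleZeta ![x.1 + 2] *
        ∑ y ∈ antidiagonal x.2, (2 : ℝ) ^ (y.1 + 2) * multipleZeta ![y.1 + 2, y.2 + 1]
      = (m + 7) / 2 * ((m + 4) * multipleZeta ![m + 5] - 2 * multipleZeta ![m + 4, 1])
        - 3 * (multipleZeta ![m + 5] + multipleZeta ![m + 3, 2] + multipleZeta ![2, m + 3]) := by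
  simp only [sum_two_pow_mul_multipleZeta]
  -- `Q` includes the term b = 2, missing from the product sum, so that its range is symmetric; that
  -- term, 3 ζ(m+3) ζ(2), is removed again through `h4`.
  set Q := ∑ x ∈ antidiagonal (m + 1),
    ((x.2 : ℝ) + 3) * (multipleZeta ![x.1 + 2] * multipleZeta ![x.2 + 2]) with hQ
  have h1 := hQ
  rw [Nat.sum_antidiagonal_succ'] at h1
  have h2 : 2 * Q = (m + 7) * ∑ x ∈ antidiagonal (m + 1),
      multipleZeta ![x.1 + 2] * multipleZeta ![x.2 + 2] := by
    have h3 : Q = ∑ x ∈ antidiagonal (m + 1),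
        ((x.1 : ℝ) + 3) * (multipleZeta ![x.2 + 2] * multipleZeta ![x.1 + 2]) := by
      rw [hQ, ← Nat.sum_antidiagonal_swap]
      rfl
    rw [two_mul]
    nth_rw 1 [h3]
    rw [hQ, ← sum_add_distrib, mul_sum]
    refine sum_congr rfl fun x hx => ?_
    have : (x.1 : ℝ) + x.2 = m + 1 := by exact_mod_cast mem_antidiagonal.1 hx
    rw [show (m : ℝ) + 7 = x.1 + x.2 + 6 by linarith]
    ring
  rw [sum_multipleZeta_mul_multipleZeta] at h2
  have h4 := multipleZeta_mul_multipleZeta_one (m + 1) 0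
  have h5 : ∑ x ∈ antidiagonal m, ((x.2 + 1 : ℕ) + 3 : ℝ)
      * (multipleZeta ![x.1 + 2] * multipleZeta ![x.2 + 1 + 2])
      = ∑ x ∈ antidiagonal m, multipleZeta ![x.1 + 2] * ((x.2 + 4) * multipleZeta ![x.2 + 3]) :=
    sum_congr rfl fun x _ => by
      push_cast
      ring
  rw [h5] at h1
  rw [← sub_eq_iff_eq_add'] at h1
  rw [← h1]
  simp only [show m + 1 + 2 = m + 3 by ring, show m + 1 + 3 = m + 4 by ring, zero_add,
    show m + 1 + 4 = m + 5 by ring, add_zero, Nat.cast_zero] at *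
  push_cast at h2 ⊢
  linear_combination h2 / 2 - 3 * h4

/-- In the two depth-two sums, the terms ζ(a+j,k) with a + j = s collect 2^2 + ⋯ + 2^(s-2) = 2^(s-1)
- 4, and ζ(j,l) arises from the l - 2 splittings l = a + k with a ≥ 2, k ≥ 1. -/
theorem sum_multipleZeta_mul_sum_two_pow_stuffle (m : ℕ) :
    ∑ x ∈ antidiagonal m, multipleZeta ![x.1 + 2] *
        ∑ y ∈ antidiagonal x.2, (2 : ℝ) ^ (y.1 + 2) * multipleZeta ![y.1 + 2, y.2 + 1]
      = ∑ x ∈ antidiagonal m, ∑ y ∈ antidiagonal x.2,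
          (2 : ℝ) ^ (y.1 + 2) * multipleZeta ![x.1 + 2, y.1 + 2, y.2 + 1]
        + ∑ x ∈ antidiagonal m, ∑ y ∈ antidiagonal x.2,
          (2 : ℝ) ^ (y.1 + 2) * multipleZeta ![y.1 + 2, x.1 + 2, y.2 + 1]
        + ∑ x ∈ antidiagonal m, ∑ y ∈ antidiagonal x.2,
          (2 : ℝ) ^ (y.1 + 2) * multipleZeta ![y.1 + 2, y.2 + 1, x.1 + 2]
        + ∑ x ∈ antidiagonal m, (2 ^ (x.1 + 3) - 4) * multipleZeta ![x.1 + 4, x.2 + 1]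
        + ∑ x ∈ antidiagonal m,
          (2 : ℝ) ^ (x.1 + 2) * (x.2 + 1) * multipleZeta ![x.1 + 2, x.2 + 3] := by
  have h4 : ∑ x ∈ antidiagonal m, ((2 : ℝ) ^ (x.1 + 3) - 4) * multipleZeta ![x.1 + 4, x.2 + 1]
      = ∑ x ∈ antidiagonal m, ∑ y ∈ antidiagonal x.2,
        (2 : ℝ) ^ (y.1 + 2) * multipleZeta ![x.1 + y.1 + 4, y.2 + 1] := by
    rw [sum_antidiagonal_assoc
      fun a b c => (2 : ℝ) ^ (b + 2) * multipleZeta ![a + b + 4, c + 1]]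
    refine sum_congr rfl fun x _ => ?_
    rw [← sum_antidiagonal_two_pow, sum_mul]
    exact sum_congr rfl fun y hy => by rw [mem_antidiagonal.1 hy]
  have h5 : ∑ x ∈ antidiagonal m,
        (2 : ℝ) ^ (x.1 + 2) * (x.2 + 1) * multipleZeta ![x.1 + 2, x.2 + 3]
      = ∑ x ∈ antidiagonal m, ∑ y ∈ antidiagonal x.2,
        (2 : ℝ) ^ (y.1 + 2) * multipleZeta ![y.1 + 2, x.1 + y.2 + 3] := by
    rw [sum_antidiagonal_swap_left
      fun a b c => (2 : ℝ) ^ (b + 2) * multipleZeta ![b + 2, a + c + 3]]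
    refine sum_congr rfl fun x _ => ?_
    have : ∀ y ∈ antidiagonal x.2, (2 : ℝ) ^ (x.1 + 2) * multipleZeta ![x.1 + 2, y.1 + y.2 + 3]
        = (2 : ℝ) ^ (x.1 + 2) * multipleZeta ![x.1 + 2, x.2 + 3] := fun y hy => by
      rw [mem_antidiagonal.1 hy]
    rw [sum_congr rfl this, sum_const, Nat.card_antidiagonal, nsmul_eq_mul]
    push_cast
    ring
  rw [h4, h5]
  simp only [← sum_add_distrib, mul_sum]
  refine sum_congr rfl fun x _ => sum_congr rfl fun y _ => ?_
  linear_combination (2 : ℝ) ^ (y.1 + 2) * multipleZeta_mul_multipleZeta_two x.1 y.1 y.2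

theorem weighted_sum_antidiagonal (m : ℕ) :
    ∑ x ∈ antidiagonal (m + 1), ∑ y ∈ antidiagonal x.2,
        ((2 : ℝ) ^ (x.1 + 3) + 2 ^ (y.1 + 1)) * multipleZeta ![x.1 + 2, y.1 + 1, y.2 + 1]
      - ∑ x ∈ antidiagonal (m + 1), (2 : ℝ) ^ (x.1 + 2) *
        (multipleZeta ![x.1 + 2, 1, x.2 + 1] + multipleZeta ![x.1 + 2, x.2 + 1, 1])
      + ∑ x ∈ antidiagonal (m + 2),
        (2 : ℝ) ^ (x.1 + 2) * (x.2 + 1) * multipleZeta ![x.1 + 2, x.2 + 1]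
    = ((m : ℝ) + 8) * (m + 6) / 2 * multipleZeta ![m + 5] - 3 * multipleZeta ![m + 3, 2]
      - (2 ^ (m + 4) + (m + 5)) * multipleZeta ![m + 4, 1] - 3 * multipleZeta ![2, m + 3] := by
  have hP := sum_multipleZeta_mul_sum_two_pow_stuffle m
  rw [sum_multipleZeta_mul_sum_two_pow] at hP
  -- The three triple sums each have one non-leading argument restricted to be at least 2. `g1`,
  -- `g2`, `g3` restore the terms where it is 1: in the middle with weight 2^k, in the middle with
  -- weight 2^j, and in the last place with weight 2^j.
  have g1 := sum_antidiagonal_sum_succ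
    (fun b a c => (2 : ℝ) ^ (b + 1) * multipleZeta ![a + 2, b + 1, c + 1]) m
  rw [sum_antidiagonal_swap_left
    (fun b a c => (2 : ℝ) ^ (b + 1) * multipleZeta ![a + 2, b + 1, c + 1]),
    sum_antidiagonal_swap_left
    (fun b a c => (2 : ℝ) ^ (b + 1 + 1) * multipleZeta ![a + 2, b + 1 + 1, c + 1])] at g1
  have g2 := sum_antidiagonal_sum_succ
    (fun a b c => (2 : ℝ) ^ (b + 2) * multipleZeta ![b + 2, a + 1, c + 1]) m
  rw [sum_antidiagonal_swap_left
    (fun a b c => (2 : ℝ) ^ (b + 2) * multipleZeta ![b + 2, a + 1, c + 1])] at g2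
  have g3 := sum_antidiagonal_sum_succ
    (fun a b c => (2 : ℝ) ^ (b + 2) * multipleZeta ![b + 2, c + 1, a + 1]) m
  rw [sum_antidiagonal_swap_left
    (fun a b c => (2 : ℝ) ^ (b + 2) * multipleZeta ![b + 2, c + 1, a + 1]),
    sum_antidiagonal_swap_right
    (fun a b c => (2 : ℝ) ^ (a + 2) * multipleZeta ![a + 2, c + 1, b + 1])] at g3
  have hT := sum_multipleZeta_three_one (m + 1)
  -- The sum formulas are trimmed to the ranges of the stuffle terms: `hW` and `hS` lose the first
  -- arguments 2 and 3, for the coefficient 2^(s-1) - 4; `hW'` loses the second arguments 1 and 2,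
  -- for the difference between the weights l and l - 2.
  have hW := sum_two_pow_mul_multipleZeta (m + 2)
  have hS := sum_multipleZeta_two (m + 2)
  have hW' := hW
  rw [Nat.sum_antidiagonal_succ, Nat.sum_antidiagonal_succ] at hW hS
  rw [Nat.sum_antidiagonal_succ', Nat.sum_antidiagonal_succ'] at hW'
  have d4 : ∑ x ∈ antidiagonal (m + 2),
        (2 : ℝ) ^ (x.1 + 2) * (x.2 + 1) * multipleZeta ![x.1 + 2, x.2 + 1]
      = 2 ^ (m + 4) * multipleZeta ![m + 4, 1] + 2 ^ (m + 4) * multipleZeta ![m + 3, 2]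
        + ∑ x ∈ antidiagonal m,
          (2 : ℝ) ^ (x.1 + 2) * (x.2 + 3) * multipleZeta ![x.1 + 2, x.2 + 3] := by
    rw [Nat.sum_antidiagonal_succ', Nat.sum_antidiagonal_succ']
    simp only [zero_add, add_assoc, Nat.reduceAdd, Nat.cast_zero, Nat.cast_add, Nat.cast_one]
    norm_num only
    ring
  simp only [zero_add, add_assoc, Nat.reduceAdd, Nat.cast_add, Nat.cast_ofNat] at hP g1 g2 g3 hT hW hS hW'
  norm_num only at hW hW'
  have d1 : ∑ x ∈ antidiagonal (m + 1), ∑ y ∈ antidiagonal x.2,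
        ((2 : ℝ) ^ (x.1 + 3) + 2 ^ (y.1 + 1)) * multipleZeta ![x.1 + 2, y.1 + 1, y.2 + 1]
      = 2 * ∑ x ∈ antidiagonal (m + 1), ∑ y ∈ antidiagonal x.2,
          (2 : ℝ) ^ (x.1 + 2) * multipleZeta ![x.1 + 2, y.1 + 1, y.2 + 1]
        + ∑ x ∈ antidiagonal (m + 1), ∑ y ∈ antidiagonal x.2,
          (2 : ℝ) ^ (y.1 + 1) * multipleZeta ![x.1 + 2, y.1 + 1, y.2 + 1] := by
    simp only [mul_sum, ← sum_add_distrib]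
    exact sum_congr rfl fun x _ => sum_congr rfl fun y _ => by ring
  have d2 : ∑ x ∈ antidiagonal m, ((2 : ℝ) ^ (x.1 + 3) - 4) * multipleZeta ![x.1 + 4, x.2 + 1]
      = 1 / 2 * ∑ x ∈ antidiagonal m, (2 : ℝ) ^ (x.1 + 4) * multipleZeta ![x.1 + 4, x.2 + 1]
        - 4 * ∑ x ∈ antidiagonal m, multipleZeta ![x.1 + 4, x.2 + 1] := by
    simp only [mul_sum, ← sum_sub_distrib]
    exact sum_congr rfl fun x _ => by ring
  have d3 : ∑ x ∈ antidiagonal m,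
        (2 : ℝ) ^ (x.1 + 2) * (x.2 + 3) * multipleZeta ![x.1 + 2, x.2 + 3]
      = ∑ x ∈ antidiagonal m,
          (2 : ℝ) ^ (x.1 + 2) * (x.2 + 1) * multipleZeta ![x.1 + 2, x.2 + 3]
        + 2 * ∑ x ∈ antidiagonal m, (2 : ℝ) ^ (x.1 + 2) * multipleZeta ![x.1 + 2, x.2 + 3] := by
    simp only [mul_sum, ← sum_add_distrib]
    exact sum_congr rfl fun x _ => by ring
  have d5 : ∑ x ∈ antidiagonal (m + 1), (2 : ℝ) ^ (x.1 + 2) *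
        (multipleZeta ![x.1 + 2, 1, x.2 + 1] + multipleZeta ![x.1 + 2, x.2 + 1, 1])
      = ∑ x ∈ antidiagonal (m + 1), (2 : ℝ) ^ (x.1 + 2) * multipleZeta ![x.1 + 2, 1, x.2 + 1]
        + ∑ x ∈ antidiagonal (m + 1), (2 : ℝ) ^ (x.1 + 2) * multipleZeta ![x.1 + 2, x.2 + 1, 1] := by
    simp only [mul_add, sum_add_distrib]
  rw [← mul_sum, hT] at g1
  rw [d2] at hP
  rw [d3] at d4
  rw [d1, d5, d4]
  linear_combination g1 + g2 + g3 - hP + 2 * hW' - hW / 2 + 4 * hS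

/-! ### Return to the index sets of the statement -/

theorem sum_filter_eq_sum_antidiagonal {M : Type*} [AddCommMonoid M] (f : ℕ → ℕ → M)
    {n N m : ℕ} (hN : N = m + 3) (hn : N ≤ n) :
    ∑ p ∈ (Icc 2 n ×ˢ Icc 1 n) with p.1 + p.2 = N, f p.1 p.2
      = ∑ x ∈ antidiagonal m, f (x.1 + 2) (x.2 + 1) := by
  refine sum_nbij' (fun p => (p.1 - 2, p.2 - 1)) (fun x => (x.1 + 2, x.2 + 1)) ?_ ?_ ?_ ?_ ?_
  · rintro ⟨a, b⟩ h
    simp only [mem_filter, mem_product, mem_Icc] at h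
    rw [HasAntidiagonal.mem_antidiagonal]
    dsimp only
    omega
  · rintro ⟨a, b⟩ h
    rw [HasAntidiagonal.mem_antidiagonal] at h
    dsimp only at h
    simp only [mem_filter, mem_product, mem_Icc]
    omega
  · rintro ⟨a, b⟩ h
    simp only [mem_filter, mem_product, mem_Icc] at h
    ext <;> dsimp only <;> omega
  · rintro ⟨a, b⟩ h
    rfl
  · rintro ⟨a, b⟩ h
    simp only [mem_filter, mem_product, mem_Icc] at h
    rw [Nat.sub_add_cancel h.1.1.1, Nat.sub_add_cancel h.1.2.1]

theorem sum_filter_eq_sum_antidiagonal_three {M : Type*} [AddCommMonoid M] (f : ℕ → ℕ → ℕ → M)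
    (m : ℕ) :
    ∑ p ∈ (Icc 2 (m + 4) ×ˢ Icc 1 (m + 4) ×ˢ Icc 1 (m + 4)) with p.1 + p.2.1 + p.2.2 = m + 4,
        f p.1 p.2.1 p.2.2
      = ∑ x ∈ antidiagonal m, ∑ y ∈ antidiagonal x.2, f (x.1 + 2) (y.1 + 1) (y.2 + 1) := by
  rw [sum_sigma']
  refine sum_nbij'
    (fun p => ⟨(p.1 - 2, p.2.1 - 1 + (p.2.2 - 1)), (p.2.1 - 1, p.2.2 - 1)⟩)
    (fun z => (z.1.1 + 2, z.2.1 + 1, z.2.2 + 1)) ?_ ?_ ?_ ?_ ?_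
  · rintro ⟨a, b, c⟩ h
    simp only [mem_filter, mem_product, mem_Icc] at h
    rw [mem_sigma, HasAntidiagonal.mem_antidiagonal, HasAntidiagonal.mem_antidiagonal]
    dsimp only
    omega
  · rintro ⟨⟨a, b⟩, ⟨c, d⟩⟩ h
    rw [mem_sigma, HasAntidiagonal.mem_antidiagonal, HasAntidiagonal.mem_antidiagonal] at h
    dsimp only at h
    simp only [mem_filter, mem_product, mem_Icc]
    omega
  · rintro ⟨a, b, c⟩ h
    simp only [mem_filter, mem_product, mem_Icc] at h
    refine Prod.ext ?_ (Prod.ext ?_ ?_) <;> dsimp only <;> omega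
  · rintro ⟨⟨a, b⟩, ⟨c, d⟩⟩ h
    rw [mem_sigma, HasAntidiagonal.mem_antidiagonal, HasAntidiagonal.mem_antidiagonal] at h
    dsimp only at h
    obtain ⟨-, rfl⟩ := h
    rfl
  · rintro ⟨a, b, c⟩ h
    simp only [mem_filter, mem_product, mem_Icc] at h
    rw [Nat.sub_add_cancel h.1.1.1, Nat.sub_add_cancel h.1.2.1.1, Nat.sub_add_cancel h.1.2.2.1]

theorem mainTheorem3 (n : ℕ) (hn : 4 ≤ n) :
    (∑ p ∈ (Finset.Icc 2 n ×ˢ Finset.Icc 1 n ×ˢ Finset.Icc 1 n) with p.1 + p.2.1 + p.2.2 = n,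
        ((2 : ℝ) ^ (p.1 + 1) + 2 ^ p.2.1) * multipleZeta ![p.1, p.2.1, p.2.2])
      - (∑ p ∈ (Finset.Icc 2 n ×ˢ Finset.Icc 1 n) with p.1 + p.2 = n - 1,
        (2 : ℝ) ^ p.1 * (multipleZeta ![p.1, 1, p.2] + multipleZeta ![p.1, p.2, 1]))
      + (∑ p ∈ (Finset.Icc 2 n ×ˢ Finset.Icc 1 n) with p.1 + p.2 = n,
        (2 : ℝ) ^ p.1 * (p.2 : ℝ) * multipleZeta ![p.1, p.2])
    = ((n : ℝ) + 3) * ((n : ℝ) + 1) / 2 * multipleZeta ![n]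
      - 3 * multipleZeta ![n - 2, 2]
      - ((2 : ℝ) ^ (n - 1) + (n : ℝ)) * multipleZeta ![n - 1, 1]
      - 3 * multipleZeta ![2, n - 2] := by
  obtain ⟨k, rfl⟩ := Nat.exists_eq_add_of_le' hn
  rw [sum_filter_eq_sum_antidiagonal_three
      (fun a b c => ((2 : ℝ) ^ (a + 1) + 2 ^ b) * multipleZeta ![a, b, c]),
    sum_filter_eq_sum_antidiagonal (m := k)
      (fun a b => (2 : ℝ) ^ a * (multipleZeta ![a, 1, b] + multipleZeta ![a, b, 1]))
      (by omega) (by omega),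
    sum_filter_eq_sum_antidiagonal (m := k + 1)
      (fun a b => (2 : ℝ) ^ a * (b : ℝ) * multipleZeta ![a, b]) (by omega) le_rfl]
  rw [show k + 4 - 1 = k + 3 by omega, show k + 4 - 2 = k + 2 by omega]
  -- For n = 4 the product sum is empty, and the depth-two formulas in weight 4 together with
  -- ζ(2,1,1) = ζ(2,2) + ζ(3,1) suffice.
  obtain _ | m := k
  · have h1 := sum_multipleZeta_two 1
    have h2 := sum_two_pow_mul_multipleZeta 1
    have h3 := sum_multipleZeta_three_one 0
    simp only [Nat.antidiagonal_zero, Nat.sum_antidiagonal_succ, sum_singleton, zero_add] at *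
    norm_num at *
    linear_combination 2 * h3 + 10 * h1 + 3 / 2 * h2
  · have h := weighted_sum_antidiagonal m
    simp only [add_assoc, Nat.reduceAdd] at h ⊢
    push_cast
    norm_num only [add_assoc, add_comm, add_left_comm] at h ⊢
    linear_combination h
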